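/- Let $k$ be a commutative ring and $A$ a commutative $k$-algebra with $\mathbb{Q}\subset A$ (i.e. $A$ is a $\mathbb{Q}$-algebra), and assume that the $A$-module $\mathrm{Der}_k(A)$ of $k$-linear derivations $A\to A$ is projective of finite rank (i.e. finitely generated projective). Put $[P,a]=P\circ a-a\circ P$ for $P\in\mathrm{End}_k(A)$ and $a\in A$ (acting by multiplication). Let $\mathcal{D}^{(0)}=\mathrm{End}_A(A)$, and for $d\geq 0$ let $\mathcal{D}^{(d+1)}$ be the set of all $P\in\mathrm{End}_k(A)$ such that $[P,a]\in\mathcal{D}^{(d)}$ for all $a\in A$; put $\mathcal{D}^{(-1)}=0$. Thus $\mathcal{D}^{(d)}$ is the left $A$-module of $k$-linear differential operators of $A$ of order $\leq d$, and $\mathcal{D}_{A/k}=\bigcup_{d}\mathcal{D}^{(d)}$ is a ring under composition. Let $$\operatorname{gr}\mathcal{D}_{A/k}=\bigoplus_{d\geq 0}\mathcal{D}^{(d)}/\mathcal{D}^{(d-1)}$$ be its associated graded ring, which is a commutative graded $A$-algebra. Then the canonical homomorphism of graded $A$-algebras $$\tau_{A/k}:\operatorname{Sym}_A\mathrm{Der}_k(A)\longrightarrow\operatorname{gr}\mathcal{D}_{A/k},$$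 i.e. the unique homomorphism of $A$-algebras sending each derivation $\delta$ to its class in $\mathcal{D}^{(1)}/\mathcal{D}^{(0)}$, is an isomorphism of graded $A$-algebras: it is bijective and, for each $d\geq 0$, maps $\operatorname{Sym}^d_A\mathrm{Der}_k(A)$ onto $\mathcal{D}^{(d)}/\mathcal{D}^{(d-1)}$. -/

import Mathlib

open scoped DirectSum

namespace DiffOps

section

set_option maxSynthPendingDepth 3

universe u v

variable (k : Type u) (A : Type v) [CommRing k] [CommRing A] [Algebra k A]

variable {k A} in
/-- The commutator `[P, a] = P ∘ a - a ∘ P` of a `k`-linear endomorphism `P` of `A` with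
(multiplication by) an element `a` of `A`, i.e. `x ↦ P (a * x) - a * P x`. -/
def bracket (P : A →ₗ[k] A) (a : A) : A →ₗ[k] A :=
  P ∘ₗ LinearMap.mulLeft k a - a • P

variable {k A} in
theorem bracket_apply (P : A →ₗ[k] A) (a x : A) : bracket P a x = P (a * x) - a * P x := rfl

variable {k A} in
theorem bracket_zero (a : A) : bracket (0 : A →ₗ[k] A) a = 0 := by
  ext x; simp [bracket_apply]

variable {k A} in
theorem bracket_add (P Q : A →ₗ[k] A) (a : A) :
    bracket (P + Q) a = bracket P a + bracket Q a := by
  ext x; simp [bracket_apply]; ring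

variable {k A} in
theorem bracket_smul (b : A) (P : A →ₗ[k] A) (a : A) :
    bracket (b • P) a = b • bracket P a := by
  ext x; simp [bracket_apply]; ring

variable {k A} in
theorem bracket_mul (P Q : A →ₗ[k] A) (a : A) :
    bracket (P * Q) a = P * bracket Q a + bracket P a * Q := by
  ext x; simp [bracket_apply]

variable {k A} in
theorem bracket_commutator (P Q : A →ₗ[k] A) (a : A) :
    bracket (P * Q - Q * P) a =
      (bracket P a * Q - Q * bracket P a) + (P * bracket Q a - bracket Q a * P) := by
  ext x; simp [bracket_apply]; ring

/-- `diffOp k A d` is the `A`-module of `k`-linear differential operators `A → A` of order `≤ d`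
(with the left `A`-module structure `(a • P) x = a * P x`). Order `≤ 0` means `A`-linear, and
`P` has order `≤ d + 1` when `[P, a]` has order `≤ d` for all `a`. -/
def diffOp : ℕ → Submodule A (A →ₗ[k] A)
  | 0 =>
    { carrier := {P | ∀ a x : A, P (a * x) = a * P x}
      zero_mem' := fun a x => by simp
      add_mem' := fun {P Q} hP hQ a x => by
        simp only [LinearMap.add_apply, hP a x, hQ a x, mul_add]
      smul_mem' := fun b P hP a x => by
        simp only [LinearMap.smul_apply, hP a x, smul_eq_mul]; ring }
  | d + 1 =>
    { carrier := {P | ∀ a : A, bracket P a ∈ diffOp d}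
      zero_mem' := fun a => by rw [bracket_zero]; exact Submodule.zero_mem _
      add_mem' := fun {P Q} hP hQ a => by
        rw [bracket_add]; exact Submodule.add_mem _ (hP a) (hQ a)
      smul_mem' := fun b P hP a => by
        rw [bracket_smul]; exact Submodule.smul_mem _ b (hP a) }

/-- Differential operators of order `< d`, i.e. of order `≤ d - 1`; zero for `d = 0`. -/
def diffOpLT : ℕ → Submodule A (A →ₗ[k] A)
  | 0 => ⊥
  | d + 1 => diffOp k A d

variable {k A}

theorem mem_diffOp_zero {P : A →ₗ[k] A} :
    P ∈ diffOp k A 0 ↔ ∀ a x : A, P (a * x) = a * P x := Iff.rfl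

theorem mem_diffOp_succ {d : ℕ} {P : A →ₗ[k] A} :
    P ∈ diffOp k A (d + 1) ↔ ∀ a : A, bracket P a ∈ diffOp k A d := Iff.rfl

theorem mem_diffOp_iff {d : ℕ} {P : A →ₗ[k] A} :
    P ∈ diffOp k A d ↔ ∀ a : A, bracket P a ∈ diffOpLT k A d := by
  cases d with
  | zero =>
    rw [mem_diffOp_zero]
    simp only [diffOpLT, Submodule.mem_bot, LinearMap.ext_iff, bracket_apply,
      LinearMap.zero_apply, sub_eq_zero]
  | succ d => exact Iff.rfl

theorem mul_mem_aux (n : ℕ) : ∀ {i j : ℕ} {P Q : A →ₗ[k] A}, i + j = n →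
    P ∈ diffOp k A i → Q ∈ diffOp k A j → P * Q ∈ diffOp k A (i + j) := by
  induction n with
  | zero =>
    intro i j P Q h hP hQ
    obtain ⟨rfl, rfl⟩ : i = 0 ∧ j = 0 := by omega
    rw [mem_diffOp_zero] at hP hQ
    refine mem_diffOp_zero.2 fun a x => ?_
    simp only [Module.End.mul_apply, hQ, hP]
  | succ n ih =>
    intro i j P Q h hP hQ
    rw [h]
    refine mem_diffOp_succ.2 fun a => ?_
    rw [bracket_mul]
    refine Submodule.add_mem _ ?_ ?_
    · have hQa := mem_diffOp_iff.1 hQ a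
      cases j with
      | zero =>
        have h0 : bracket Q a = 0 := hQa
        rw [h0, mul_zero]; exact Submodule.zero_mem _
      | succ j =>
        obtain rfl : n = i + j := by omega
        exact ih rfl hP hQa
    · have hPa := mem_diffOp_iff.1 hP a
      cases i with
      | zero =>
        have h0 : bracket P a = 0 := hPa
        rw [h0, zero_mul]; exact Submodule.zero_mem _
      | succ i =>
        obtain rfl : n = i + j := by omega
        exact ih rfl hPa hQ

theorem mul_mem {i j : ℕ} {P Q : A →ₗ[k] A} (hP : P ∈ diffOp k A i) (hQ : Q ∈ diffOp k A j) :
    P * Q ∈ diffOp k A (i + j) := mul_mem_aux _ rfl hP hQ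

theorem mul_mem_LT_left {i j : ℕ} {P Q : A →ₗ[k] A} (hP : P ∈ diffOpLT k A i)
    (hQ : Q ∈ diffOp k A j) : P * Q ∈ diffOpLT k A (i + j) := by
  cases i with
  | zero =>
    have h0 : P = 0 := hP
    rw [h0, zero_mul]; exact Submodule.zero_mem _
  | succ i =>
    rw [show i + 1 + j = (i + j) + 1 by omega]
    exact mul_mem (i := i) (j := j) hP hQ

theorem mul_mem_LT_right {i j : ℕ} {P Q : A →ₗ[k] A} (hP : P ∈ diffOp k A i)
    (hQ : Q ∈ diffOpLT k A j) : P * Q ∈ diffOpLT k A (i + j) := by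
  cases j with
  | zero =>
    have h0 : Q = 0 := hQ
    rw [h0, mul_zero]; exact Submodule.zero_mem _
  | succ j => exact mul_mem (i := i) (j := j) hP hQ

theorem commutator_mem_aux (n : ℕ) : ∀ {i j : ℕ} {P Q : A →ₗ[k] A}, i + j = n →
    P ∈ diffOp k A i → Q ∈ diffOp k A j → P * Q - Q * P ∈ diffOpLT k A (i + j) := by
  induction n with
  | zero =>
    intro i j P Q h hP hQ
    obtain ⟨rfl, rfl⟩ : i = 0 ∧ j = 0 := by omega
    rw [mem_diffOp_zero] at hP hQ
    have key : P * Q - Q * P = 0 := by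
      ext x
      have hP' : ∀ y, P y = y * P 1 := fun y => by simpa using hP y 1
      have hQ' : ∀ y, Q y = y * Q 1 := fun y => by simpa using hQ y 1
      simp only [LinearMap.sub_apply, Module.End.mul_apply, LinearMap.zero_apply]
      rw [hP' (Q x), hQ' x, hQ' (P x), hP' x]; ring
    rw [key]; exact Submodule.zero_mem _
  | succ n ih =>
    intro i j P Q h hP hQ
    rw [h]
    refine mem_diffOp_iff.2 fun a => ?_
    rw [bracket_commutator]
    refine Submodule.add_mem _ ?_ ?_
    · have hPa := mem_diffOp_iff.1 hP a
      cases i with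
      | zero =>
        have h0 : bracket P a = 0 := hPa
        rw [h0, zero_mul, mul_zero, sub_zero]; exact Submodule.zero_mem _
      | succ i =>
        obtain rfl : n = i + j := by omega
        exact ih rfl hPa hQ
    · have hQa := mem_diffOp_iff.1 hQ a
      cases j with
      | zero =>
        have h0 : bracket Q a = 0 := hQa
        rw [h0, zero_mul, mul_zero, sub_zero]; exact Submodule.zero_mem _
      | succ j =>
        obtain rfl : n = i + j := by omega
        exact ih rfl hP hQa

theorem commutator_mem {i j : ℕ} {P Q : A →ₗ[k] A} (hP : P ∈ diffOp k A i)
    (hQ : Q ∈ diffOp k A j) : P * Q - Q * P ∈ diffOpLT k A (i + j) :=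
  commutator_mem_aux _ rfl hP hQ

/-- Multiplication by `a`, a differential operator of order `≤ 0`. -/
def mulOp (a : A) : diffOp k A 0 :=
  ⟨LinearMap.mulLeft k a, fun b x => by simp only [LinearMap.mulLeft_apply]; ring⟩

/-- A `k`-derivation of `A`, as a differential operator of order `≤ 1`. -/
def derOp : Derivation k A A →ₗ[A] diffOp k A 1 where
  toFun D := ⟨D.toLinearMap, fun a => mem_diffOp_zero.2 fun b x => by
    simp only [bracket_apply, Derivation.coeFn_coe,
      Derivation.leibniz, smul_eq_mul]
    ring⟩
  map_add' _ _ := rfl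
  map_smul' _ _ := rfl

variable (k A)

/-- The degree `d` piece of the associated graded ring: operators of order `≤ d` modulo operators
of order `≤ d - 1`. -/
def gr (d : ℕ) : Type v := diffOp k A d ⧸ (diffOpLT k A d).submoduleOf (diffOp k A d)

instance (d : ℕ) : AddCommGroup (gr k A d) :=
  inferInstanceAs (AddCommGroup (_ ⧸ (diffOpLT k A d).submoduleOf (diffOp k A d)))

instance (d : ℕ) : Module A (gr k A d) :=
  inferInstanceAs (Module A (_ ⧸ (diffOpLT k A d).submoduleOf (diffOp k A d)))

/-- The symbol `σ_d(P)`: the class in degree `d` of an operator `P` of order `≤ d`. -/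
def symbol (d : ℕ) : diffOp k A d →ₗ[A] gr k A d :=
  ((diffOpLT k A d).submoduleOf (diffOp k A d)).mkQ

variable {k A}

theorem symbol_surjective (d : ℕ) : Function.Surjective (symbol k A d) :=
  Submodule.mkQ_surjective _

theorem symbol_eq_iff {d : ℕ} {P Q : diffOp k A d} :
    symbol k A d P = symbol k A d Q ↔ (P : A →ₗ[k] A) - Q ∈ diffOpLT k A d :=
  Submodule.Quotient.eq _

/-- Multiplication on the graded pieces, induced by the composition of operators:
`σ_i(P) σ_j(Q) = σ_{i+j}(P ∘ Q)`. -/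
def grMul {i j : ℕ} : gr k A i → gr k A j → gr k A (i + j) :=
  Quotient.map₂ (fun P Q => ⟨P.1 * Q.1, mul_mem P.2 Q.2⟩) <| by
    intro P P' hP Q Q' hQ
    have hP' : (P : A →ₗ[k] A) - P' ∈ diffOpLT k A i :=
      symbol_eq_iff.1 (Quotient.sound hP : symbol k A i P = symbol k A i P')
    have hQ' : (Q : A →ₗ[k] A) - Q' ∈ diffOpLT k A j :=
      symbol_eq_iff.1 (Quotient.sound hQ : symbol k A j Q = symbol k A j Q')
    refine Quotient.exact (symbol_eq_iff.2 ?_ :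
      symbol k A (i + j) ⟨P.1 * Q.1, _⟩ = symbol k A (i + j) ⟨P'.1 * Q'.1, _⟩)
    have : P.1 * Q.1 - P'.1 * Q'.1 = (P.1 - P'.1) * Q.1 + P'.1 * (Q.1 - Q'.1) := by
      rw [sub_mul, mul_sub]; abel
    change P.1 * Q.1 - P'.1 * Q'.1 ∈ _
    rw [this]
    exact Submodule.add_mem _ (mul_mem_LT_left hP' Q.2) (mul_mem_LT_right P'.2 hQ')

theorem grMul_symbol {i j : ℕ} (P : diffOp k A i) (Q : diffOp k A j) :
    grMul (symbol k A i P) (symbol k A j Q) =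
      symbol k A (i + j) ⟨P.1 * Q.1, mul_mem P.2 Q.2⟩ := rfl

theorem mk_symbol_eq {i j : ℕ} (h : i = j) {P : diffOp k A i} {Q : diffOp k A j}
    (hPQ : (P : A →ₗ[k] A) - Q ∈ diffOpLT k A i) :
    GradedMonoid.mk (A := gr k A) i (symbol k A i P) = .mk j (symbol k A j Q) := by
  subst h
  rw [symbol_eq_iff.2 hPQ]

theorem mk_symbol_eq' {i j : ℕ} (h : i = j) {P : diffOp k A i} {Q : diffOp k A j}
    (hPQ : (P : A →ₗ[k] A) = Q) :
    GradedMonoid.mk (A := gr k A) i (symbol k A i P) = .mk j (symbol k A j Q) :=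
  mk_symbol_eq h (by rw [hPQ, sub_self]; exact Submodule.zero_mem _)

instance : GradedMonoid.GMul (gr k A) where
  mul := grMul

/-- The unit of the associated graded ring is the symbol of the identity operator. -/
instance : GradedMonoid.GOne (gr k A) where
  one := symbol k A 0 (mulOp 1)

/-- `⨁ d, gr k A d` is a commutative graded ring. -/
instance : DirectSum.GCommRing (gr k A) where
  mul_zero {i j} a := by
    obtain ⟨P, rfl⟩ := symbol_surjective i a
    change grMul _ _ = _
    rw [← map_zero (symbol k A j), grMul_symbol, ← map_zero (symbol k A (i + j))]
    exact congrArg _ (Subtype.ext (mul_zero P.1))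
  zero_mul {i j} b := by
    obtain ⟨Q, rfl⟩ := symbol_surjective j b
    change grMul _ _ = _
    rw [← map_zero (symbol k A i), grMul_symbol, ← map_zero (symbol k A (i + j))]
    exact congrArg _ (Subtype.ext (zero_mul Q.1))
  mul_add {i j} a b c := by
    obtain ⟨P, rfl⟩ := symbol_surjective i a
    obtain ⟨Q, rfl⟩ := symbol_surjective j b
    obtain ⟨R, rfl⟩ := symbol_surjective j c
    change grMul _ _ = grMul _ _ + grMul _ _
    rw [← map_add, grMul_symbol, grMul_symbol, grMul_symbol, ← map_add]
    exact congrArg _ (Subtype.ext (mul_add P.1 Q.1 R.1))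
  add_mul {i j} a b c := by
    obtain ⟨P, rfl⟩ := symbol_surjective i a
    obtain ⟨Q, rfl⟩ := symbol_surjective i b
    obtain ⟨R, rfl⟩ := symbol_surjective j c
    change grMul _ _ = grMul _ _ + grMul _ _
    rw [← map_add, grMul_symbol, grMul_symbol, grMul_symbol, ← map_add]
    exact congrArg _ (Subtype.ext (add_mul P.1 Q.1 R.1))
  one_mul := by
    rintro ⟨i, a⟩
    obtain ⟨P, rfl⟩ := symbol_surjective i a
    refine mk_symbol_eq' (P := ⟨(mulOp (k := k) (1 : A)).1 * P.1, _⟩) (zero_add i) ?_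
    ext x; simp [mulOp]
  mul_one := by
    rintro ⟨i, a⟩
    obtain ⟨P, rfl⟩ := symbol_surjective i a
    refine mk_symbol_eq' (P := ⟨P.1 * (mulOp (k := k) (1 : A)).1, _⟩) (add_zero i) ?_
    ext x; simp [mulOp]
  mul_assoc := by
    rintro ⟨i, a⟩ ⟨j, b⟩ ⟨l, c⟩
    obtain ⟨P, rfl⟩ := symbol_surjective i a
    obtain ⟨Q, rfl⟩ := symbol_surjective j b
    obtain ⟨R, rfl⟩ := symbol_surjective l c
    exact mk_symbol_eq' (P := ⟨P.1 * Q.1 * R.1, mul_mem (mul_mem P.2 Q.2) R.2⟩)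
      (Q := ⟨P.1 * (Q.1 * R.1), mul_mem P.2 (mul_mem Q.2 R.2)⟩)
      (add_assoc i j l) (mul_assoc P.1 Q.1 R.1)
  mul_comm := by
    rintro ⟨i, a⟩ ⟨j, b⟩
    obtain ⟨P, rfl⟩ := symbol_surjective i a
    obtain ⟨Q, rfl⟩ := symbol_surjective j b
    exact mk_symbol_eq (P := ⟨P.1 * Q.1, mul_mem P.2 Q.2⟩) (Q := ⟨Q.1 * P.1, mul_mem Q.2 P.2⟩)
      (add_comm i j) (commutator_mem P.2 Q.2)
  natCast n := symbol k A 0 (mulOp n)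
  natCast_zero := by
    rw [← map_zero (symbol k A 0)]
    congr 1; ext x; simp [mulOp]
  natCast_succ n := by
    change _ = _ + symbol k A 0 (mulOp 1)
    rw [← map_add]
    congr 1; ext x; simp [mulOp, add_mul]
  intCast n := symbol k A 0 (mulOp n)
  intCast_ofNat n := by rw [Int.cast_natCast]
  intCast_negSucc_ofNat n := by
    rw [← map_neg]
    congr 1; ext x; simp [mulOp, Int.negSucc_eq]; ring

/-- The structural map `A → gr⁰`, sending `a` to the symbol of the multiplication by `a`, makes the
associated graded ring an `A`-algebra. -/
instance : DirectSum.GAlgebra A (gr k A) where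
  toFun :=
    { toFun := fun a => symbol k A 0 (mulOp a)
      map_zero' := by
        rw [← map_zero (symbol k A 0)]
        congr 1; ext x; simp [mulOp]
      map_add' := fun a b => by
        rw [← map_add]
        congr 1; ext x; simp [mulOp, add_mul] }
  map_one := rfl
  map_mul r s := by
    refine mk_symbol_eq' (Q := ⟨(mulOp (k := k) r).1 * (mulOp (k := k) s).1, _⟩) rfl ?_
    ext x; simp [mulOp]
  commutes _ _ := mul_comm _ _
  smul_def r := by
    rintro ⟨i, a⟩
    obtain ⟨P, rfl⟩ := symbol_surjective i a
    refine mk_symbol_eq' (P := r • P) (Q := ⟨(mulOp (k := k) r).1 * P.1, _⟩) (zero_add i).symm ?_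
    ext x; simp [mulOp]

variable (k A)

/-- The canonical map `τ : Sym_A Der_k(A) → gr D_{A/k}` of `A`-algebras: the unique one extending
`Der_k(A) → gr¹`, `δ ↦ σ_1(δ)`. -/
noncomputable def tau : SymmetricAlgebra A (Derivation k A A) →ₐ[A] ⨁ d, gr k A d :=
  SymmetricAlgebra.lift (DirectSum.lof A ℕ (gr k A) 1 ∘ₗ symbol k A 1 ∘ₗ derOp)

/-- The degree `d` part `Sym^d_A M` of the symmetric algebra: the `A`-span of the products of `d`
elements of `M`. -/
noncomputable def symPow (M : Type*) [AddCommGroup M] [Module A M] (d : ℕ) :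
    Submodule A (SymmetricAlgebra A M) :=
  LinearMap.range (SymmetricAlgebra.ι A M) ^ d

end

end DiffOps

namespace DiffOps

open SymmetricAlgebra (ι)

section Graded

set_option maxSynthPendingDepth 3

variable {k A : Type*} [CommRing k] [CommRing A] [Algebra k A]

/-! On `gr` the operator `P ↦ [P, a]` lowers the degree by one, is a derivation in `a`, and commutes
with bracketing by `b`. By the recursive definition of order, a class of positive degree killed by
all these brackets is zero. So a class of degree `d` behaves like a symmetric `d`-linear form in
derivations.

Finite projectivity gives a dual basis `δ i`, `φ i` of `Der_k(A)`. For a linear form `f` on `gr^d`,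
`a ↦ f [x, a]` is a derivation, to which `φ i` applies; iterating yields coordinates `c_I(x)`, with
`I` a `d`-tuple of indices. An Euler-type formula holds (`factorial_smul_eq_sum_grMonomial`): `d! x
= ∑ c_I(x) σ(δ_{I 0} ⋯ δ_{I (d-1)})`. Over `ℚ`, dividing by `d!` suggests the inverse `x ↦ (1/d!) ∑
c_I(x) δ_{I 0} ⋯ δ_{I (d-1)}`, and the formula makes it a right inverse of `tau`. It is a left
inverse because it commutes with multiplication by derivations (`grToSym_grDerMul`), which generate
`Sym`. -/

theorem bracket_mem {d : ℕ} {P : A →ₗ[k] A} (hP : P ∈ diffOp k A (d + 1)) (a : A) :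
    bracket P a ∈ diffOp k A d := hP a

theorem bracket_mem_LT {d : ℕ} {P : A →ₗ[k] A} (hP : P ∈ diffOpLT k A (d + 1)) (a : A) :
    bracket P a ∈ diffOpLT k A d := mem_diffOp_iff.1 hP a

/-! ### Brackets, contractions and monomials on the graded pieces -/

theorem symbol_eq_zero_iff {d : ℕ} {P : diffOp k A d} :
    symbol k A d P = 0 ↔ (P : A →ₗ[k] A) ∈ diffOpLT k A d := by
  rw [← map_zero (symbol k A d), symbol_eq_iff]; simp

/-- A linear map out of `gr k A d`, given on operators. -/
def grLift {N : Type*} [AddCommGroup N] [Module A N] {d : ℕ} (f : diffOp k A d →ₗ[A] N)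
    (hf : ∀ P : diffOp k A d, (P : A →ₗ[k] A) ∈ diffOpLT k A d → f P = 0) :
    gr k A d →ₗ[A] N :=
  Submodule.liftQ ((diffOpLT k A d).submoduleOf (diffOp k A d)) f fun P hP => hf P hP

theorem grLift_symbol {N : Type*} [AddCommGroup N] [Module A N] {d : ℕ}
    (f : diffOp k A d →ₗ[A] N)
    (hf : ∀ P : diffOp k A d, (P : A →ₗ[k] A) ∈ diffOpLT k A d → f P = 0) (P : diffOp k A d) :
    grLift f hf (symbol k A d P) = f P := rfl

/-- The map `gr^{d+1} → gr^d` induced by `P ↦ [P, a]`. -/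
def grBracket (d : ℕ) (a : A) : gr k A (d + 1) →ₗ[A] gr k A d :=
  grLift
    { toFun := fun P => symbol k A d ⟨bracket P.1 a, bracket_mem P.2 a⟩
      map_add' := fun P Q => by
        rw [← map_add]; exact congrArg _ (Subtype.ext (bracket_add P.1 Q.1 a))
      map_smul' := fun b P => by
        rw [RingHom.id_apply, ← map_smul]
        exact congrArg _ (Subtype.ext (bracket_smul b P.1 a)) }
    fun _ hP => symbol_eq_zero_iff.2 (bracket_mem_LT hP a)

theorem grBracket_symbol {d : ℕ} (a : A) (P : diffOp k A (d + 1)) :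
    grBracket d a (symbol k A (d + 1) P) =
      symbol k A d ⟨bracket P.1 a, bracket_mem P.2 a⟩ := rfl

theorem grBracket_add {d : ℕ} (a b : A) (x : gr k A (d + 1)) :
    grBracket d (a + b) x = grBracket d a x + grBracket d b x := by
  obtain ⟨P, rfl⟩ := symbol_surjective _ x
  simp only [grBracket_symbol]
  rw [← map_add]
  refine congrArg _ (Subtype.ext (LinearMap.ext fun y => ?_))
  simp [bracket_apply, add_mul]; ring

theorem grBracket_smul {d : ℕ} (r : k) (a : A) (x : gr k A (d + 1)) :
    grBracket d (r • a) x = algebraMap k A r • grBracket d a x := by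
  obtain ⟨P, rfl⟩ := symbol_surjective _ x
  simp only [grBracket_symbol]
  rw [← map_smul]
  refine congrArg _ (Subtype.ext (LinearMap.ext fun y => ?_))
  simp [bracket_apply, smul_sub]

/-- The error in the Leibniz rule is the double bracket `[[P, a], b]`, whose order is too low to be
seen in `gr^d`. This makes `contract` take values in derivations. -/
theorem grBracket_mul {d : ℕ} (a b : A) (x : gr k A (d + 1)) :
    grBracket d (a * b) x = a • grBracket d b x + b • grBracket d a x := by
  obtain ⟨P, rfl⟩ := symbol_surjective _ x
  simp only [grBracket_symbol]
  rw [← map_smul, ← map_smul, ← map_add]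
  refine symbol_eq_iff.2 ?_
  have h : bracket P.1 (a * b) - (a • bracket P.1 b + b • bracket P.1 a) =
      bracket (bracket P.1 a) b := by
    ext y; simp [bracket_apply, mul_assoc]; ring
  exact h ▸ mem_diffOp_iff.1 (bracket_mem P.2 a) b

/-- Multiplication operators commute. This is the source of the symmetry of the coordinates. -/
theorem grBracket_comm {d : ℕ} (a b : A) (x : gr k A (d + 2)) :
    grBracket d a (grBracket (d + 1) b x) = grBracket d b (grBracket (d + 1) a x) := by
  obtain ⟨P, rfl⟩ := symbol_surjective _ x
  simp only [grBracket_symbol]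
  refine congrArg _ (Subtype.ext (LinearMap.ext fun y => ?_))
  simp only [bracket_apply, mul_left_comm a b y]; ring

theorem eq_zero_of_grBracket {d : ℕ} (x : gr k A (d + 1)) (h : ∀ a, grBracket d a x = 0) :
    x = 0 := by
  obtain ⟨P, rfl⟩ := symbol_surjective _ x
  exact symbol_eq_zero_iff.2 (mem_diffOp_iff.2 fun a => symbol_eq_zero_iff.1 (h a))

theorem der_mul_mem {d : ℕ} (D : Derivation k A A) {P : A →ₗ[k] A} (hP : P ∈ diffOp k A d) :
    D.toLinearMap * P ∈ diffOp k A (d + 1) := by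
  rw [add_comm]; exact mul_mem (derOp D).2 hP

/-- Left multiplication by the symbol of a derivation, as a map `gr^d → gr^{d+1}`. -/
def grDerMul (d : ℕ) (D : Derivation k A A) : gr k A d →ₗ[A] gr k A (d + 1) :=
  grLift
    { toFun := fun P => symbol k A (d + 1) ⟨D.toLinearMap * P.1, der_mul_mem D P.2⟩
      map_add' := fun P Q => by
        rw [← map_add]; exact congrArg _ (Subtype.ext (mul_add D.toLinearMap P.1 Q.1))
      map_smul' := fun b P => by
        rw [RingHom.id_apply, ← map_smul]
        refine symbol_eq_iff.2 ?_
        -- Composition with `D` is `A`-linear only modulo lower order: the defect has order `≤ d`.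
        have h : D.toLinearMap * (b • P.1) - b • (D.toLinearMap * P.1) = D b • P.1 := by
          ext y; simp [mul_comm]
        exact h ▸ Submodule.smul_mem _ (D b) P.2 }
    fun P hP => symbol_eq_zero_iff.2 <| by
      change _ * _ ∈ _
      rw [add_comm]; exact mul_mem_LT_right (derOp D).2 hP

theorem grDerMul_symbol {d : ℕ} (D : Derivation k A A) (P : diffOp k A d) :
    grDerMul d D (symbol k A d P) =
      symbol k A (d + 1) ⟨D.toLinearMap * P.1, der_mul_mem D P.2⟩ := rfl

theorem grBracket_grDerMul_zero (a : A) (D : Derivation k A A) (x : gr k A 0) :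
    grBracket 0 a (grDerMul 0 D x) = D a • x := by
  obtain ⟨P, rfl⟩ := symbol_surjective _ x
  rw [grDerMul_symbol, grBracket_symbol, ← map_smul]
  refine congrArg _ (Subtype.ext (LinearMap.ext fun y => ?_))
  simp [bracket_apply, mem_diffOp_zero.1 P.2 a y]; ring

/-- Product rule for the commutator, with `[D, a]` equal to multiplication by `D a`. -/
theorem grBracket_grDerMul_succ {d : ℕ} (a : A) (D : Derivation k A A) (x : gr k A (d + 1)) :
    grBracket (d + 1) a (grDerMul (d + 1) D x) =
      grDerMul d D (grBracket d a x) + D a • x := by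
  obtain ⟨P, rfl⟩ := symbol_surjective _ x
  rw [grDerMul_symbol, grBracket_symbol, grBracket_symbol, grDerMul_symbol, ← map_smul,
    ← map_add]
  refine congrArg _ (Subtype.ext (LinearMap.ext fun y => ?_))
  simp [bracket_apply]; ring

/-- The derivation `a ↦ f [x, a]` attached to a linear form `f` on `gr^d` and `x ∈ gr^{d+1}`. -/
def contract {d : ℕ} (f : gr k A d →ₗ[A] A) : gr k A (d + 1) →ₗ[A] Derivation k A A where
  toFun x := Derivation.mk'
    { toFun := fun a => f (grBracket d a x)
      map_add' := fun a b => by rw [grBracket_add, map_add]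
      map_smul' := fun r a => by
        rw [grBracket_smul, map_smul, RingHom.id_apply, algebraMap_smul] }
    fun a b => by
      change f _ = a • f _ + b • f _
      rw [grBracket_mul, map_add, map_smul, map_smul]
  map_add' x y := by ext a; simp
  map_smul' b x := by ext a; simp

theorem contract_apply {d : ℕ} (f : gr k A d →ₗ[A] A) (x : gr k A (d + 1)) (a : A) :
    contract f x a = f (grBracket d a x) := rfl

/-- The symbol of the composition of `d` derivations. -/
def grMonomial : (d : ℕ) → (Fin d → Derivation k A A) → gr k A d
  | 0, _ => symbol k A 0 (mulOp 1)
  | d + 1, l => grDerMul d (l 0) (grMonomial d (Fin.tail l))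

theorem grMonomial_succ {d : ℕ} (l : Fin (d + 1) → Derivation k A A) :
    grMonomial (d + 1) l = grDerMul d (l 0) (grMonomial d (Fin.tail l)) := rfl

theorem tail_removeNth_succ {α : Type*} {d : ℕ} (j : Fin (d + 1)) (l : Fin (d + 2) → α) :
    Fin.tail (j.succ.removeNth l) = j.removeNth (Fin.tail l) := by
  ext i; simp [Fin.tail, Fin.removeNth]

theorem removeNth_succ_zero {α : Type*} {d : ℕ} (j : Fin (d + 1)) (l : Fin (d + 2) → α) :
    (j.succ.removeNth l : Fin (d + 1) → α) 0 = l 0 := by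
  simp [Fin.removeNth]

theorem grBracket_grMonomial (a : A) {d : ℕ} (l : Fin (d + 1) → Derivation k A A) :
    grBracket d a (grMonomial (d + 1) l) = ∑ j, l j a • grMonomial d (j.removeNth l) := by
  induction d with
  | zero =>
    rw [grMonomial_succ, grBracket_grDerMul_zero]
    simp
  | succ d ih =>
    rw [grMonomial_succ, grBracket_grDerMul_succ, ih, map_sum, Fin.sum_univ_succ (n := d + 1),
      add_comm (∑ j, _)]
    refine congrArg₂ _ (by simp) (Finset.sum_congr rfl fun j _ => ?_)
    rw [map_smul, grMonomial_succ (j.succ.removeNth l), tail_removeNth_succ,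
      removeNth_succ_zero]
    rfl

/-- Evaluation at `1` of the operators of order zero. -/
def grEvalOne : gr k A 0 →ₗ[A] A :=
  grLift
    { toFun := fun P => P.1 1
      map_add' := fun _ _ => rfl
      map_smul' := fun _ _ => rfl }
    fun P hP => by
      have h : P.1 = 0 := hP
      simp [h]

theorem grEvalOne_smul (x : gr k A 0) : grEvalOne x • symbol k A 0 (mulOp 1) = x := by
  obtain ⟨P, rfl⟩ := symbol_surjective _ x
  rw [← map_smul]
  refine congrArg _ (Subtype.ext (LinearMap.ext fun y => ?_))
  have h := mem_diffOp_zero.1 P.2 y 1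
  rw [mul_one] at h
  change P.1 1 * (1 * y) = P.1 y
  rw [h]; ring

theorem derivation_sum_apply {ι : Type*} (s : Finset ι) (D : ι → Derivation k A A) (a : A) :
    (∑ i ∈ s, D i) a = ∑ i ∈ s, D i a := by
  rw [← Derivation.coeFnAddMonoidHom_apply, map_sum, Finset.sum_apply]; rfl

/-! ### Coordinates from a dual basis and the Euler formula -/

section Coordinates

variable {n : ℕ} (φ : Fin n → Derivation k A A →ₗ[A] A)

/-- The coordinates of an element of `gr^d` with respect to linear forms on the derivations. -/
def grCoord : (d : ℕ) → (Fin d → Fin n) → gr k A d →ₗ[A] A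
  | 0, _ => grEvalOne
  | d + 1, I => φ (I 0) ∘ₗ contract (grCoord d (Fin.tail I))

theorem grCoord_succ {d : ℕ} (I : Fin (d + 1) → Fin n) (x : gr k A (d + 1)) :
    grCoord φ (d + 1) I x = φ (I 0) (contract (grCoord φ d (Fin.tail I)) x) := rfl

/-- Iterated product rule: each slot of `I` may be the one that absorbs `D`. The dual basis property
plays no role here. -/
theorem grCoord_grDerMul (D : Derivation k A A) {d : ℕ} (I : Fin (d + 1) → Fin n)
    (x : gr k A d) :
    grCoord φ (d + 1) I (grDerMul d D x) =
      ∑ j, φ (I j) D * grCoord φ d (j.removeNth I) x := by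
  induction d with
  | zero =>
    have h : contract (grCoord φ 0 (Fin.tail I)) (grDerMul 0 D x) =
        grCoord φ 0 (Fin.tail I) x • D := by
      ext a
      rw [contract_apply, grBracket_grDerMul_zero]
      simp [mul_comm]
    rw [grCoord_succ, h, map_smul]
    simp [mul_comm]
  | succ d ih =>
    have h : contract (grCoord φ (d + 1) (Fin.tail I)) (grDerMul (d + 1) D x) =
        grCoord φ (d + 1) (Fin.tail I) x • D + ∑ j, φ (Fin.tail I j) D •
          contract (grCoord φ d (j.removeNth (Fin.tail I))) x := by
      ext a
      rw [contract_apply, grBracket_grDerMul_succ, map_add, ih, map_smul, add_comm,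
        Derivation.add_apply, derivation_sum_apply]
      simp [contract_apply, mul_comm]
    rw [grCoord_succ, h, map_add, map_sum, Fin.sum_univ_succ (n := d + 1)]
    refine congrArg₂ (· + ·) ?_ (Finset.sum_congr rfl fun j _ => ?_)
    · rw [map_smul, smul_eq_mul, mul_comm, Fin.removeNth_zero]
    rw [map_smul, grCoord_succ, tail_removeNth_succ, removeNth_succ_zero]
    rfl

variable {φ} {δ : Fin n → Derivation k A A}

/-- In slot `0` this expands the derivation `contract _ x` in the dual basis. The other slots reduce
to it because brackets commute, so the result does not depend on `j`. -/
theorem sum_grCoord_insertNth (hδ : ∀ D, ∑ i, φ i D • δ i = D)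
    (a : A) {d : ℕ} (j : Fin (d + 1)) (J : Fin d → Fin n)
    (x : gr k A (d + 1)) :
    ∑ i, δ i a * grCoord φ (d + 1) (j.insertNth i J) x = grCoord φ d J (grBracket d a x) := by
  have h_zero : ∀ {d : ℕ} (J : Fin d → Fin n) (x : gr k A (d + 1)),
      ∑ i, δ i a * grCoord φ (d + 1) ((0 : Fin (d + 1)).insertNth i J) x =
        grCoord φ d J (grBracket d a x) := by
    intro d J x
    rw [← contract_apply, ← hδ (contract (grCoord φ d J) x), derivation_sum_apply]
    refine Finset.sum_congr rfl fun i _ => ?_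
    rw [Fin.insertNth_zero', grCoord_succ, Fin.cons_zero, Fin.tail_cons, mul_comm]
    rfl
  induction d with
  | zero =>
    obtain rfl : j = 0 := Fin.fin_one_eq_zero j
    exact h_zero J x
  | succ d ih =>
    cases j using Fin.cases with
    | zero => exact h_zero J x
    | succ j =>
      have hJ : Fin.cons (J 0) (Fin.tail J) = J := Fin.cons_self_tail J
      have h : contract (grCoord φ d (Fin.tail J)) (grBracket (d + 1) a x) =
          ∑ i, δ i a • contract (grCoord φ (d + 1) (j.insertNth i (Fin.tail J))) x := by
        ext b
        rw [contract_apply, grBracket_comm, ← ih j, derivation_sum_apply]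
        rfl
      rw [grCoord_succ φ J, h, map_sum]
      refine Finset.sum_congr rfl fun i _ => ?_
      rw [map_smul, smul_eq_mul]
      conv_lhs => rw [← hJ, Fin.insertNth_succ_cons, grCoord_succ, Fin.cons_zero, Fin.tail_cons]

/-- Isolates the entry of `I` in slot `j`, so that the innermost sum runs over the dual basis alone.
-/
theorem sum_sum_eq_sum_sum_insertNth {N : Type*} [AddCommMonoid N] {d : ℕ}
    (F : (Fin (d + 1) → Fin n) → Fin (d + 1) → N) :
    ∑ I, ∑ j, F I j = ∑ j, ∑ J : Fin d → Fin n, ∑ i, F (j.insertNth i J) j := by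
  rw [Finset.sum_comm]
  refine Finset.sum_congr rfl fun j _ => ?_
  rw [← (Fin.insertNthEquiv (fun _ => Fin n) j).sum_comp, Fintype.sum_prod_type_right]
  rfl

theorem factorial_smul_eq_sum_grMonomial (hδ : ∀ D, ∑ i, φ i D • δ i = D)
    {d : ℕ} (x : gr k A d) :
    (d.factorial : A) • x = ∑ I, grCoord φ d I x • grMonomial d (δ ∘ I) := by
  induction d with
  | zero => simpa [grCoord, grMonomial] using (grEvalOne_smul x).symm
  | succ d ih =>
    -- Brackets detect zero in positive degree, so both sides are compared after bracketing with
    -- `a`.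
    refine sub_eq_zero.1 (eq_zero_of_grBracket _ fun a => ?_)
    rw [map_sub, sub_eq_zero, map_smul, map_sum]
    have h : ∀ I : Fin (d + 1) → Fin n,
        grBracket d a (grCoord φ (d + 1) I x • grMonomial (d + 1) (δ ∘ I)) =
          ∑ j, (δ (I j) a * grCoord φ (d + 1) I x) • grMonomial d (δ ∘ j.removeNth I) := by
      intro I
      rw [map_smul, grBracket_grMonomial, Finset.smul_sum]
      refine Finset.sum_congr rfl fun j _ => ?_
      rw [smul_smul, mul_comm]
      rfl
    simp only [h]
    rw [sum_sum_eq_sum_sum_insertNth]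
    simp only [Fin.insertNth_apply_same, Fin.removeNth_insertNth, ← Finset.sum_smul,
      sum_grCoord_insertNth hδ, ← ih]
    -- All `d + 1` slots contribute the same term, which turns `d!` into `(d + 1)!`.
    rw [Finset.sum_const, Finset.card_univ, Fintype.card_fin, ← Nat.cast_smul_eq_nsmul A,
      smul_assoc, smul_smul, Nat.factorial_succ, Nat.cast_mul]

variable (φ δ) in
/-- The map `gr^d → Sym_A Der_k(A)` which is `d!` times the inverse of `tau` in degree `d`. -/
noncomputable def grToSym (d : ℕ) : gr k A d →ₗ[A] SymmetricAlgebra A (Derivation k A A) :=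
  ∑ I : Fin d → Fin n, (grCoord φ d I).smulRight (∏ j, ι A _ (δ (I j)))

theorem grToSym_apply {d : ℕ} (x : gr k A d) :
    grToSym φ δ d x = ∑ I, grCoord φ d I x • ∏ j, ι A _ (δ (I j)) := by
  simp [grToSym]

/-- Commutativity of `Sym` lets the factor in the slot absorbing `D` be pulled out; summed over the
dual basis it becomes `D`, once for each of the `d + 1` slots. -/
theorem grToSym_grDerMul (hδ : ∀ D, ∑ i, φ i D • δ i = D)
    (D : Derivation k A A) {d : ℕ} (x : gr k A d) :
    grToSym φ δ (d + 1) (grDerMul d D x) = ((d + 1 : ℕ) : A) • (ι A _ D * grToSym φ δ d x) := by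
  have h : ∀ I : Fin (d + 1) → Fin n,
      grCoord φ (d + 1) I (grDerMul d D x) • ∏ j, ι A _ (δ (I j)) =
        ∑ j, (φ (I j) D • ι A _ (δ (I j))) *
          (grCoord φ d (j.removeNth I) x • ∏ l, ι A _ (δ (j.removeNth I l))) := by
    intro I
    rw [grCoord_grDerMul, Finset.sum_smul]
    refine Finset.sum_congr rfl fun j _ => ?_
    rw [smul_mul_smul_comm, Fin.prod_univ_succAbove _ j]
    rfl
  rw [grToSym_apply, grToSym_apply]
  simp only [h]
  rw [sum_sum_eq_sum_sum_insertNth]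
  simp only [Fin.insertNth_apply_same, Fin.removeNth_insertNth, ← Finset.sum_mul, ← map_smul,
    ← map_sum, hδ, ← Finset.mul_sum]
  rw [Finset.sum_const, Finset.card_univ, Fintype.card_fin, ← Nat.cast_smul_eq_nsmul A, map_smul,
    smul_mul_assoc]

end Coordinates

/-! ### The map `tau` on products of derivations -/

theorem tau_ι (D : Derivation k A A) :
    tau k A (ι A _ D) = DirectSum.lof A ℕ (gr k A) 1 (symbol k A 1 (derOp D)) :=
  SymmetricAlgebra.lift_ι_apply _ _

theorem lof_symbol_derOp_mul (D : Derivation k A A) {d : ℕ} (x : gr k A d) :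
    DirectSum.lof A ℕ (gr k A) 1 (symbol k A 1 (derOp D)) * DirectSum.lof A ℕ (gr k A) d x =
      DirectSum.lof A ℕ (gr k A) (d + 1) (grDerMul d D x) := by
  obtain ⟨P, rfl⟩ := symbol_surjective _ x
  rw [DirectSum.lof_eq_of, DirectSum.lof_eq_of, DirectSum.lof_eq_of, DirectSum.of_mul_of]
  -- The degrees `1 + d` and `d + 1` are only propositionally equal, so the classes are compared in
  -- the graded monoid.
  exact DirectSum.of_eq_of_gradedMonoid_eq
    (mk_symbol_eq' (P := ⟨D.toLinearMap * P.1, mul_mem (derOp D).2 P.2⟩)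
      (Q := ⟨D.toLinearMap * P.1, der_mul_mem D P.2⟩) (add_comm 1 d) rfl)

theorem tau_prod {d : ℕ} (l : Fin d → Derivation k A A) :
    tau k A (∏ j, ι A _ (l j)) = DirectSum.lof A ℕ (gr k A) d (grMonomial d l) := by
  induction d with
  | zero => rw [Fin.prod_univ_zero, map_one]; rfl
  | succ d ih =>
    rw [Fin.prod_univ_succ, map_mul, tau_ι, grMonomial_succ, ← lof_symbol_derOp_mul]
    exact congrArg _ (ih (Fin.tail l))

theorem prod_mem_symPow {M : Type*} [AddCommGroup M] [Module A M] {d : ℕ} (l : Fin d → M) :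
    ∏ j, ι A M (l j) ∈ symPow A M d := by
  induction d with
  | zero => rw [Fin.prod_univ_zero]; exact Submodule.one_le.1 le_rfl
  | succ d ih =>
    rw [Fin.prod_univ_succ, symPow, pow_succ']
    exact Submodule.mul_mem_mul ⟨_, rfl⟩ (ih (Fin.tail l))

theorem map_tau_symPow_le (d : ℕ) :
    (symPow A (Derivation k A A) d).map (tau k A).toLinearMap ≤
      LinearMap.range (DirectSum.lof A ℕ (gr k A) d) := by
  rw [Submodule.map_le_iff_le_comap]
  induction d with
  | zero =>
    rw [symPow, pow_zero, Submodule.one_le]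
    exact ⟨symbol k A 0 (mulOp 1), (map_one (tau k A)).symm⟩
  | succ d ih =>
    rw [symPow, pow_succ', Submodule.mul_le]
    rintro _ ⟨D, rfl⟩ y hy
    obtain ⟨x, hx⟩ := ih hy
    refine ⟨grDerMul d D x, ?_⟩
    rw [← lof_symbol_derOp_mul, hx, ← tau_ι]
    exact (map_mul (tau k A) _ _).symm

/-! ### Division by `d!` and the inverse of `tau` -/

section Inverse

variable [Algebra ℚ A] {n : ℕ} (φ : Fin n → Derivation k A A →ₗ[A] A)
  (δ : Fin n → Derivation k A A)

theorem ratCast_inv_mul_natCast {m : ℕ} (hm : m ≠ 0) :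
    algebraMap ℚ A (m : ℚ)⁻¹ * (m : A) = 1 := by
  rw [← map_natCast (algebraMap ℚ A), ← map_mul, inv_mul_cancel₀ (by exact_mod_cast hm), map_one]

/-- The inverse of `tau`. -/
noncomputable def tauInv : (⨁ d, gr k A d) →ₗ[A] SymmetricAlgebra A (Derivation k A A) :=
  DirectSum.toModule A ℕ _ fun d =>
    algebraMap ℚ A (d.factorial : ℚ)⁻¹ • grToSym φ δ d

theorem tauInv_lof {d : ℕ} (x : gr k A d) :
    tauInv φ δ (DirectSum.lof A ℕ (gr k A) d x) =
      algebraMap ℚ A (d.factorial : ℚ)⁻¹ • grToSym φ δ d x := by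
  rw [tauInv, DirectSum.toModule_lof]; rfl

theorem tauInv_lof_mem {d : ℕ} (x : gr k A d) :
    tauInv φ δ (DirectSum.lof A ℕ (gr k A) d x) ∈ symPow A (Derivation k A A) d := by
  rw [tauInv_lof, grToSym_apply]
  exact Submodule.smul_mem _ _ (Submodule.sum_mem _ fun I _ =>
    Submodule.smul_mem _ _ (prod_mem_symPow _))

variable {φ δ}

theorem tau_tauInv_lof (hδ : ∀ D, ∑ i, φ i D • δ i = D)
    {d : ℕ} (x : gr k A d) :
    tau k A (tauInv φ δ (DirectSum.lof A ℕ (gr k A) d x)) = DirectSum.lof A ℕ (gr k A) d x := by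
  rw [tauInv_lof, map_smul, grToSym_apply, map_sum]
  simp only [map_smul, tau_prod]
  simp only [← map_smul, ← map_sum]
  have h := factorial_smul_eq_sum_grMonomial hδ x
  simp only [Function.comp_def] at h
  rw [← h, smul_smul, ratCast_inv_mul_natCast d.factorial_ne_zero, one_smul]

theorem tau_tauInv (hδ : ∀ D, ∑ i, φ i D • δ i = D)
    (x : ⨁ d, gr k A d) : tau k A (tauInv φ δ x) = x := by
  have h : (tau k A).toLinearMap ∘ₗ tauInv φ δ = LinearMap.id :=
    DirectSum.linearMap_ext A fun d => LinearMap.ext fun x => tau_tauInv_lof hδ x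
  exact LinearMap.congr_fun h x

/-- The factor `d + 1` from `grToSym_grDerMul` cancels against `1/(d + 1)!`, leaving `1/d!`. -/
theorem tauInv_ι_mul (hδ : ∀ D, ∑ i, φ i D • δ i = D)
    (D : Derivation k A A) (x : ⨁ d, gr k A d) :
    tauInv φ δ (tau k A (ι A _ D) * x) = ι A _ D * tauInv φ δ x := by
  have h : tauInv φ δ ∘ₗ LinearMap.mulLeft A (tau k A (ι A _ D)) =
      LinearMap.mulLeft A (ι A _ D) ∘ₗ tauInv φ δ := by
    refine DirectSum.linearMap_ext A fun d => LinearMap.ext fun x => ?_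
    simp only [LinearMap.comp_apply, LinearMap.mulLeft_apply]
    rw [tau_ι, lof_symbol_derOp_mul, tauInv_lof, tauInv_lof, grToSym_grDerMul hδ, smul_smul,
      mul_smul_comm, Nat.factorial_succ, Nat.cast_mul, mul_inv_rev, map_mul, mul_assoc,
      ratCast_inv_mul_natCast d.succ_ne_zero, mul_one]
  exact LinearMap.congr_fun h x

theorem tauInv_one : tauInv φ δ (1 : ⨁ d, gr k A d) = 1 := by
  have h := tauInv_lof φ δ (symbol k A 0 (mulOp 1))
  refine (h.trans ?_)
  rw [grToSym_apply]
  simp [grCoord, grEvalOne, grLift_symbol, mulOp]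

/-- Linearity over `Sym` passes from generators to all of `Sym`; at `x = 1` it says that `tauInv` is
a left inverse. Keeping `x` arbitrary is what lets the product case go through. -/
theorem tauInv_tau_mul (hδ : ∀ D, ∑ i, φ i D • δ i = D)
    (s : SymmetricAlgebra A (Derivation k A A)) :
    ∀ x : ⨁ d, gr k A d, tauInv φ δ (tau k A s * x) = s * tauInv φ δ x := by
  induction s using SymmetricAlgebra.induction with
  | algebraMap r => intro x; rw [AlgHom.commutes, ← Algebra.smul_def, map_smul, Algebra.smul_def]
  | ι D => exact tauInv_ι_mul hδ D
  | mul s t hs ht => intro x; rw [map_mul (tau k A), mul_assoc, hs, ht, mul_assoc]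
  | add s t hs ht => intro x; rw [map_add (tau k A), add_mul, map_add, hs, ht, add_mul]

theorem tauInv_tau (hδ : ∀ D, ∑ i, φ i D • δ i = D)
    (s : SymmetricAlgebra A (Derivation k A A)) :
    tauInv φ δ (tau k A s) = s := by
  simpa [tauInv_one] using tauInv_tau_mul hδ s 1

end Inverse

/-- A finitely generated projective module has a finite dual basis. -/
theorem exists_dual_basis (M : Type*) [AddCommGroup M] [Module A M] [Module.Finite A M]
    [Module.Projective A M] : ∃ (n : ℕ) (φ : Fin n → M →ₗ[A] A) (δ : Fin n → M),
      ∀ D, ∑ i, φ i D • δ i = D := by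
  obtain ⟨n, f, g, -, -, hfg⟩ := Module.Finite.exists_comp_eq_id_of_projective A M
  refine ⟨n, fun i => LinearMap.proj i ∘ₗ g, fun i => f (Pi.single i 1), fun D => ?_⟩
  conv_rhs => rw [← LinearMap.id_apply (R := A) D, ← hfg, LinearMap.comp_apply,
    pi_eq_sum_univ' (g D), map_sum]
  refine Finset.sum_congr rfl fun i _ => ?_
  rw [map_smul]
  congr 2

end Graded

end DiffOps

theorem mainTheorem7 {k : Type*} {A : Type*} [CommRing k] [CommRing A] [Algebra k A]
    [Algebra ℚ A] [Module.Finite A (Derivation k A A)]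
    [Module.Projective A (Derivation k A A)] :
    Function.Bijective (DiffOps.tau k A) ∧
      ∀ d : ℕ, (DiffOps.symPow A (Derivation k A A) d).map (DiffOps.tau k A).toLinearMap =
        LinearMap.range (DirectSum.lof A ℕ (DiffOps.gr k A) d) := by
  obtain ⟨n, φ, δ, hδ⟩ := DiffOps.exists_dual_basis (A := A) (Derivation k A A)
  refine ⟨⟨Function.LeftInverse.injective (DiffOps.tauInv_tau hδ),
    Function.RightInverse.surjective (DiffOps.tau_tauInv hδ)⟩, fun d =>
    le_antisymm (DiffOps.map_tau_symPow_le d) ?_⟩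
  rintro _ ⟨x, rfl⟩
  -- The preimage given by the inverse is a combination of products of `d` derivations.
  exact ⟨_, DiffOps.tauInv_lof_mem φ δ x, DiffOps.tau_tauInv_lof hδ x⟩
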